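/- Setting. Let $n,k,d,t\ge 1$ be integers with $t\mid k$, $k\le d$ and $d+t\le n$, and let $\mathcal M>0$ be the size of a file. The file is encoded on $n$ devices. In a repair, an arbitrary set of $t$ devices fails and $t$ new devices replace them: each new device (1) receives from each of $d$ live devices, which may be any $d$ live devices and may differ from one new device to another, a message of size $\beta$ computed from what that live device stores, (2) receives from each of the $t-1$ other new devices a message of size $\beta'$ computed from what the latter received in step (1), and (3) stores an amount $\alpha$ of information computed from what it has received. The coding functions of a repair may depend on the current and the earlier repairs, not on later ones. The sizes are real numbers in a common unit of information: they refer to finite alphabets with at least $2^{s\mathcal M}$ files, and with at most $2^{s\alpha}$ contents of a device and at most $2^{s\beta}$, $2^{s\beta'}$ messages, for some real $s>0$. The values $(\alpha,\beta,\beta')$ are *correct* if there is such a scheme for which, after every finite succession of repairs, the file can be recovered without error from the contents of any $k$ devices. The repair cost is $\gamma=d\beta+(t-1)\beta'$. A code $(n,k,d,t,\alpha,\gamma)$ is *correct* if $(\alpha,\beta,\beta')$ is correct for some $\beta,\beta'$ with $\gamma=d\beta+(t-1)\beta'$; it is *optimal* if it is correct and no code $(n,k,d,t,\bar\alpha,\bar\gamma)$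 with $(\bar\alpha,\bar\gamma)<(\alpha,\gamma)$ is correct, where $(\bar a,\bar b)<(a,b)$ means that $\bar a\le a$ and $\bar b<b$, or $\bar a<a$ and $\bar b\le b$. For real $\alpha,\beta,\beta'$ and a vector $\mathbf u=(u_0,\dots,u_{g-1})$ of integers with $1\le u_i\le t$ and $\sum_i u_i=k$, consider the constraint $$\sum_{i=0}^{g-1}u_i\min\Bigl\{\alpha,\Bigl(d-\sum_{j=0}^{i-1}u_j\Bigr)\beta+(t-u_i)\beta'\Bigr\}\ \ge\ \mathcal M .\qquad(C_{\mathbf u})$$ Theorem (MBCR codes). Let $$\alpha=\frac{\mathcal M}{k}\,\frac{2d+t-1}{2d-k+t},\qquad \beta=\frac{\mathcal M}{k}\,\frac{2}{2d-k+t},\qquad \beta'=\frac{\mathcal M}{k}\,\frac{1}{2d-k+t},\qquad \gamma=d\beta+(t-1)\beta'.$$ 1. $\gamma=\alpha$. 2. (Correctness) $(\alpha,\beta,\beta')$ satisfies $(C_{\mathbf u})$ for every $\mathbf u$; the values $(\alpha,\beta,\beta')$, and hence the code $(n,k,d,t,\alpha,\gamma)$, are correct. 3. (Smaller values) Let $\bar\alpha,\bar\beta,\bar\beta'$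 be real and $\bar\gamma=d\bar\beta+(t-1)\bar\beta'$. If $\bar\beta<\beta$, then $(C_{\mathbf u})$ fails for $\mathbf u=(t,\dots,t)$. If $\bar\gamma<\gamma$ or $(\bar\alpha,\bar\gamma)<(\alpha,\gamma)$, then $(C_{\mathbf u})$ fails for $\mathbf u=(t,\dots,t)$ or for $\mathbf u=(1,\dots,1)$. If all $(C_{\mathbf u})$ hold and $\bar\gamma=\gamma$, then $\bar\beta=\beta$ and, when $t\ge2$, $\bar\beta'=\beta'$. 4. (Optimality) The code $(n,k,d,t,\alpha,\gamma)$ is optimal. Moreover every correct code $(n,k,d,t,\bar\alpha,\bar\gamma)$ has $\bar\gamma\ge\gamma$, and $\bar\alpha\ge\alpha$ if $\bar\gamma=\gamma$. -/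

import Mathlib

namespace CoordRegen

/-! ### The storage system, its repairs, and coding schemes -/

/-- One simultaneous repair in a system of `n` devices: `t` devices fail and each of the `t`
spare devices that replace them (under the same labels) contacts `d` live devices of its own. -/
structure Repair (n d t : ℕ) where
  failed : Finset (Fin n)
  card_failed : failed.card = t
  helpers : {j // j ∈ failed} → Finset (Fin n)
  card_helpers : ∀ j, (helpers j).card = d
  helpers_live : ∀ j, Disjoint (helpers j) failed

/-- A succession of repairs, the most recent one first. -/
abbrev History (n d t : ℕ) := List (Repair n d t)

/-- What the new device `j` gets in the collecting step of `r`: one message from each of its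
`d` helpers. -/
abbrev Collected {n d t : ℕ} (r : Repair n d t) (j : {j // j ∈ r.failed}) (Msg : Type) :=
  {i // i ∈ r.helpers j} → Msg

/-- What the new device `j` gets in the coordinating step of `r`: one message from each of the
`t - 1` other new devices. -/
abbrev Exchanged {n d t : ℕ} (r : Repair n d t) (j : {j // j ∈ r.failed}) (Coord : Type) :=
  {l : {l // l ∈ r.failed} // l ≠ j} → Coord

/-- The functions by which the devices operate. All functions used in a repair `r` may depend on
the succession `h` of the earlier repairs (repair is functional, not necessarily exact), but not
on later ones. -/
structure Scheme (n d t : ℕ) (File Store Msg Coord : Type) where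
  /-- the initial content of the devices -/
  encode : Fin n → File → Store
  /-- the message sent by the live device `i`, computed from what it stores, to the new device `j` -/
  collect : History n d t → (r : Repair n d t) → (j : {j // j ∈ r.failed}) →
    {i // i ∈ r.helpers j} → Store → Msg
  /-- the message sent by the new device `l`, computed from what it collected, to the new
  device `j` -/
  coordinate : History n d t → (r : Repair n d t) → (l j : {j // j ∈ r.failed}) →
    Collected r l Msg → Coord
  /-- what the new device `j` stores, computed from all that it received -/
  store : History n d t → (r : Repair n d t) → (j : {j // j ∈ r.failed}) →
    Collected r j Msg → Exchanged r j Coord → Store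

/-- The content of every device after the succession of repairs `h`, when the file is `x`. -/
def Scheme.content {n d t : ℕ} {File Store Msg Coord : Type}
    (S : Scheme n d t File Store Msg Coord) (x : File) : History n d t → Fin n → Store
  | [] => fun i => S.encode i x
  | r :: h => fun j =>
      let collected : (l : {l // l ∈ r.failed}) → Collected r l Msg :=
        fun l i => S.collect h r l i (S.content x h i.1)
      if hj : j ∈ r.failed then
        S.store h r ⟨j, hj⟩ (collected ⟨j, hj⟩)
          (fun l => S.coordinate h r l.1 ⟨j, hj⟩ (collected l.1))
      else
        S.content x h j

/-- After any succession of repairs, the file can be recovered from any `k` devices. -/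
def Scheme.Recovers {n d t : ℕ} {File Store Msg Coord : Type}
    (S : Scheme n d t File Store Msg Coord) (k : ℕ) : Prop :=
  ∀ (h : History n d t) (K : Finset (Fin n)), K.card = k →
    ∃ decode : ({i // i ∈ K} → Store) → File,
      ∀ x : File, decode (fun i => S.content x h i.1) = x

/-- The repair cost of a device: `d` messages of size `β` and `t - 1` messages of size `β'`. -/
def repairCost (d t : ℕ) (β β' : ℝ) : ℝ := d * β + ((t : ℝ) - 1) * β'

/-- The amounts `α` (stored), `β` (collected from a helper), `β'` (received from another new
device) allow to store a file of size `M`. Only the ratios of the real numbers `M, α, β, β'`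
matter, so the unit of information is left free: one unit is `s` bits for some real `s > 0`. -/
def IsCorrectWith (n k d t : ℕ) (M α β β' : ℝ) : Prop :=
  ∃ s : ℝ, 0 < s ∧
    ∃ (File Store Msg Coord : Type) (_ : Fintype File) (_ : Fintype Store) (_ : Fintype Msg)
      (_ : Fintype Coord),
      (2 : ℝ) ^ (s * M) ≤ (Fintype.card File : ℝ) ∧
      (Fintype.card Store : ℝ) ≤ (2 : ℝ) ^ (s * α) ∧
      (Fintype.card Msg : ℝ) ≤ (2 : ℝ) ^ (s * β) ∧
      (Fintype.card Coord : ℝ) ≤ (2 : ℝ) ^ (s * β') ∧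
      ∃ S : Scheme n d t File Store Msg Coord, S.Recovers k

/-- Correctness of the code `(n, k, d, t, α, γ)` for a file of size `M`. -/
def IsCorrect (n k d t : ℕ) (M α γ : ℝ) : Prop :=
  ∃ β β' : ℝ, γ = repairCost d t β β' ∧ IsCorrectWith n k d t M α β β'

/-- Optimality of the code `(n, k, d, t, α, γ)`; the order on pairs is the product order, that is
`(a', b') < (a, b)` iff `a' < a ∧ b' ≤ b` or `a' ≤ a ∧ b' < b`. -/
def IsOptimal (n k d t : ℕ) (M α γ : ℝ) : Prop :=
  IsCorrect n k d t M α γ ∧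
    ∀ α₁ γ₁ : ℝ, (α₁, γ₁) < (α, γ) → ¬ IsCorrect n k d t M α₁ γ₁

/-! ### The constraints indexed by the recovery scenarios -/

/-- A recovery scenario: `u i` is the number of contacted devices in the `i`-th repair group. -/
def IsScenario (k t : ℕ) {g : ℕ} (u : Fin g → ℕ) : Prop :=
  (∑ i, u i = k) ∧ ∀ i, 1 ≤ u i ∧ u i ≤ t

/-- `∑ i, u i * min {α, (d - ∑_{j < i} u j) β + (t - u i) β'}`. -/
noncomputable def scenarioFlow (d t : ℕ) (α β β' : ℝ) {g : ℕ} (u : Fin g → ℕ) : ℝ :=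
  ∑ i, (u i : ℝ) *
    min α (((d : ℝ) - ∑ j ∈ Finset.Iio i, (u j : ℝ)) * β + ((t : ℝ) - u i) * β')

/-- The constraint of every recovery scenario. -/
def SatisfiesConstraints (k d t : ℕ) (M α β β' : ℝ) : Prop :=
  ∀ (g : ℕ) (u : Fin g → ℕ), IsScenario k t u → M ≤ scenarioFlow d t α β β' u

/-- The scenario `(t, …, t)`, with `k / t` entries (used when `t` divides `k`). -/
def scenarioAll (k t : ℕ) : Fin (k / t) → ℕ := fun _ => t

/-- The scenario `(1, …, 1)`, with `k` entries. -/
def scenarioOne (k : ℕ) : Fin k → ℕ := fun _ => 1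

/-! ### The minimum bandwidth point -/

noncomputable def mbcrAlpha (k d t : ℕ) (M : ℝ) : ℝ :=
  M / k * ((2 * d + t - 1) / (2 * d - k + t))

noncomputable def mbcrBeta (k d t : ℕ) (M : ℝ) : ℝ :=
  M / k * (2 / (2 * d - k + t))

noncomputable def mbcrBeta' (k d t : ℕ) (M : ℝ) : ℝ :=
  M / k * (1 / (2 * d - k + t))

end CoordRegen

/-! Converse (`IsCorrectWith.satisfiesConstraints`): blocks of `t` devices fail in turn, each block
starting right after the `m` devices already counted. Its new devices all contact those `m`, so each
needs only `d - m` further messages. The first `u` devices of the block therefore add at most `u`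
stored contents, or at most `(d - m) * u` collected and `(t - u) * u` coordinating messages, to what
determines the joint content. Recovery makes the joint content of `k` devices injective in the file,
and counting gives every constraint.

Put `b = β'`, so that `M = k(2d - k + t)b`. The scenario `(t, …, t)` does not involve `β'` and
forces `β ≥ 2b`; then `(1, …, 1)` forces repair cost at least `(2d + t - 1)b` and, at equality,
storage at least that much.

Achievability (`exists_recovering_scheme`): the file is a polynomial `f(X, Y)` of degree `< d` in
`X` and `< d + t` in `Y`, without monomials of degree `≥ k` in both variables: `k(2d - k + t)`
coefficients. Device `i` has a point `p_i` and stores `f(X, p_i)` and `f(p_i, Y)`; these agree at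
`(p_i, p_i)`, which saves one symbol. A helper sends two values of `f`, a fellow new device one.
That the constraints hold at this point is deduced from the code through the converse. -/

namespace CoordRegen

/-! ### Upper bounds on the flow of constant scenarios -/

theorem scenarioFlow_succ (d t : ℕ) (α β β' : ℝ) {g : ℕ} (u : Fin (g + 1) → ℕ) :
    scenarioFlow d t α β β' u =
      scenarioFlow d t α β β' (fun i => u i.castSucc) +
        (u (Fin.last g) : ℝ) * min α (((d : ℝ) - ∑ i : Fin g, (u i.castSucc : ℝ)) * β +
          ((t : ℝ) - u (Fin.last g)) * β') := by
  have h1 : ∀ i : Fin g, ∑ j ∈ Finset.Iio i.castSucc, (u j : ℝ) =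
      ∑ j ∈ Finset.Iio i, (u j.castSucc : ℝ) := fun i => by
    rw [← Fin.map_castSuccEmb_Iio, Finset.sum_map]; rfl
  have h2 : ∑ j ∈ Finset.Iio (Fin.last g), (u j : ℝ) = ∑ i : Fin g, (u i.castSucc : ℝ) := by
    rw [Fin.Iio_last_eq_map, Finset.sum_map]; rfl
  simp only [scenarioFlow, Fin.sum_univ_castSucc, h1, h2]

theorem scenarioFlow_const_le (d t c g : ℕ) (α β β' : ℝ) :
    scenarioFlow d t α β β' (fun _ : Fin g => c) ≤
      g * c * (d * β + (t - c) * β') - c ^ 2 * β * (g * (g - 1) / 2) := by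
  induction g with
  | zero => simp [scenarioFlow]
  | succ g ih =>
    rw [scenarioFlow_succ]
    have := mul_le_mul_of_nonneg_left
      (min_le_right α (((d : ℝ) - ∑ i : Fin g, (c : ℝ)) * β + ((t : ℝ) - c) * β'))
      (Nat.cast_nonneg (α := ℝ) c)
    simp only [Finset.sum_const, Finset.card_univ, Fintype.card_fin, nsmul_eq_mul] at this ⊢
    push_cast
    linarith

/-- The minimum of the first block is bounded by `α`, all others by their bandwidth term; this makes
storage visible in the bound. -/
theorem scenarioFlow_const_le_storage (d t c g : ℕ) (α β β' : ℝ) :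
    scenarioFlow d t α β β' (fun _ : Fin (g + 1) => c) ≤
      c * α + g * c * (d * β + (t - c) * β') - c ^ 2 * β * ((g + 1) * g / 2) := by
  induction g with
  | zero =>
    have := mul_le_mul_of_nonneg_left
      (min_le_left α ((d : ℝ) * β + ((t : ℝ) - c) * β')) (Nat.cast_nonneg (α := ℝ) c)
    simpa [scenarioFlow_succ, scenarioFlow] using this
  | succ g ih =>
    rw [scenarioFlow_succ]
    have := mul_le_mul_of_nonneg_left
      (min_le_right α (((d : ℝ) - ∑ i : Fin (g + 1), (c : ℝ)) * β + ((t : ℝ) - c) * β'))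
      (Nat.cast_nonneg (α := ℝ) c)
    simp only [Finset.sum_const, Finset.card_univ, Fintype.card_fin, nsmul_eq_mul] at this ⊢
    push_cast at this ⊢
    linarith

theorem scenarioFlow_scenarioAll_le {k t : ℕ} (d : ℕ) (htk : t ∣ k) (α β β' : ℝ) :
    scenarioFlow d t α β β' (scenarioAll k t) ≤ β * (k * (2 * d - k + t)) / 2 := by
  have hg : ((k / t : ℕ) : ℝ) * t = k := by exact_mod_cast Nat.div_mul_cancel htk
  refine (scenarioFlow_const_le d t t (k / t) α β β').trans_eq ?_
  generalize ((k / t : ℕ) : ℝ) = g at hg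
  rw [← hg]
  ring

theorem scenarioFlow_scenarioOne_le (d t k : ℕ) (α β β' : ℝ) :
    scenarioFlow d t α β β' (scenarioOne k) ≤
      k * repairCost d t β β' - β * (k * (k - 1) / 2) := by
  unfold scenarioOne
  simpa [repairCost] using scenarioFlow_const_le d t 1 k α β β'

theorem scenarioFlow_scenarioOne_le_storage (d t : ℕ) {k : ℕ} (hk : 1 ≤ k) (α β β' : ℝ) :
    scenarioFlow d t α β β' (scenarioOne k) ≤
      α + (k - 1) * repairCost d t β β' - β * (k * (k - 1) / 2) := by
  obtain ⟨g, rfl⟩ := Nat.exists_eq_add_of_le' hk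
  unfold scenarioOne
  simpa [repairCost] using scenarioFlow_const_le_storage d t 1 g α β β'

theorem isScenario_scenarioAll {k t : ℕ} (ht : 1 ≤ t) (htk : t ∣ k) :
    IsScenario k t (scenarioAll k t) :=
  ⟨by simp [scenarioAll, Nat.div_mul_cancel htk], fun _ => ⟨ht, le_rfl⟩⟩

theorem isScenario_scenarioOne {k t : ℕ} (ht : 1 ≤ t) : IsScenario k t (scenarioOne k) :=
  ⟨by simp [scenarioOne], fun _ => ⟨le_rfl, ht⟩⟩

/-! ### The cut-set bound by counting joint contents -/

/-- A value of `f` is determined by the values of `g` and `e` at one chosen preimage. -/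
theorem ncard_range_le_mul_card {X A B E : Type*} [Finite X] [Fintype E] (f : X → A) (g : X → B)
    (e : X → E) (h : ∀ x y, g x = g y → e x = e y → f x = f y) :
    (Set.range f).ncard ≤ (Set.range g).ncard * Fintype.card E := by
  rw [← Nat.card_eq_fintype_card, ← Nat.card_coe_set_eq, ← Nat.card_coe_set_eq, ← Nat.card_prod]
  choose p hp using fun a : Set.range f => a.2
  refine Nat.card_le_card_of_injective
    (fun a => ((⟨g (p a), p a, rfl⟩ : Set.range g), e (p a))) fun a b hab => ?_
  obtain ⟨h1, h2⟩ := Prod.ext_iff.1 hab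
  exact Subtype.ext (by rw [← hp a, ← hp b, h _ _ (congrArg Subtype.val h1) h2])

/-- The devices `m, …, m + t - 1` fail; all new devices contact `0, …, m - 1` and
`m + t, …, d + t - 1`. -/
def blockRepair {n d t m : ℕ} (hm : m ≤ d) (hn : d + t ≤ n) : Repair n d t where
  failed := (Finset.Ico m (m + t)).attachFin fun i hi => by
    have := Finset.mem_Ico.1 hi; omega
  card_failed := by simp
  helpers _ := (Finset.range m ∪ Finset.Ico (m + t) (d + t)).attachFin fun i hi => by
    simp only [Finset.mem_union, Finset.mem_range, Finset.mem_Ico] at hi; omega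
  card_helpers _ := by
    rw [Finset.card_attachFin, Finset.card_union_of_disjoint]
    · simp; omega
    · rw [Finset.disjoint_left]
      intro i hi hi'
      simp only [Finset.mem_range, Finset.mem_Ico] at hi hi'
      omega
  helpers_live _ := by
    rw [Finset.disjoint_left]
    intro i hi hi'
    simp only [Finset.mem_attachFin, Finset.mem_union, Finset.mem_range, Finset.mem_Ico] at hi hi'
    omega

section blockRepair

variable {n d t m : ℕ} (hm : m ≤ d) (hn : d + t ≤ n)

theorem mem_failed_blockRepair {i : Fin n} :
    i ∈ (blockRepair hm hn).failed ↔ m ≤ i.1 ∧ i.1 < m + t := by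
  simp [blockRepair]

theorem mem_helpers_blockRepair {j : {j // j ∈ (blockRepair hm hn).failed}} {i : Fin n} :
    i ∈ (blockRepair hm hn).helpers j ↔ i.1 < m ∨ (m + t ≤ i.1 ∧ i.1 < d + t) := by
  simp [blockRepair]

end blockRepair

namespace Scheme

variable {n d t : ℕ} {File Store Msg Coord : Type} (S : Scheme n d t File Store Msg Coord)

/-- The messages that the new device `l` collects in the repair `r` after `h`. -/
def collected (x : File) (h : History n d t) (r : Repair n d t) (l : {l // l ∈ r.failed}) :
    Collected r l Msg :=
  fun i => S.collect h r l i (S.content x h i.1)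

theorem content_cons_of_mem (x : File) (h : History n d t) (r : Repair n d t) {j : Fin n}
    (hj : j ∈ r.failed) :
    S.content x (r :: h) j = S.store h r ⟨j, hj⟩ (S.collected x h r ⟨j, hj⟩)
      (fun l => S.coordinate h r l.1 ⟨j, hj⟩ (S.collected x h r l.1)) := by
  rw [content]; exact dif_pos hj

theorem content_cons_of_notMem (x : File) (h : History n d t) (r : Repair n d t) {j : Fin n}
    (hj : j ∉ r.failed) : S.content x (r :: h) j = S.content x h j := by
  rw [content]; exact dif_neg hj

/-- The joint content of the first `m` devices. -/
def prefixContent (m : ℕ) (h : History n d t) (x : File) : {i : Fin n // i.1 < m} → Store :=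
  fun i => S.content x h i.1

variable {m u : ℕ} (hm : m ≤ d) (hn : d + t ≤ n)

theorem ncard_range_prefixContent_le_store [Finite File] [Fintype Store]
    (hut : u ≤ t) (h : History n d t) :
    (Set.range (S.prefixContent (m + u) (blockRepair hm hn :: h))).ncard ≤
      (Set.range (S.prefixContent m h)).ncard * Fintype.card Store ^ u := by
  rw [show Fintype.card Store ^ u = Fintype.card (Fin u → Store) by simp]
  refine ncard_range_le_mul_card _ _
    (fun x (a : Fin u) => S.content x (blockRepair hm hn :: h) ⟨m + a, by omega⟩)
    fun x y hg he => funext fun ⟨i, hi⟩ => ?_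
  by_cases him : i.1 < m
  · have hi' : i ∉ (blockRepair hm hn).failed := by rw [mem_failed_blockRepair]; omega
    simp only [prefixContent, content_cons_of_notMem _ _ _ _ hi']
    exact congrFun hg ⟨i, him⟩
  · have := congrFun he ⟨i.1 - m, by omega⟩
    have hi2 : (⟨m + (i.1 - m), by omega⟩ : Fin n) = i := Fin.ext (by simp; omega)
    simpa only [hi2, prefixContent] using this

theorem ncard_range_prefixContent_le_messages [Finite File] [Fintype Msg] [Fintype Coord]
    (hut : u ≤ t) (h : History n d t) :
    (Set.range (S.prefixContent (m + u) (blockRepair hm hn :: h))).ncard ≤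
      (Set.range (S.prefixContent m h)).ncard *
        (Fintype.card Msg ^ ((d - m) * u) * Fintype.card Coord ^ ((t - u) * u)) := by
  set r := blockRepair hm hn with hr
  have hF : ∀ a : ℕ, a < t → ∀ ha : m + a < n, (⟨m + a, ha⟩ : Fin n) ∈ r.failed := fun a _ _ => by
    rw [hr, mem_failed_blockRepair]; simp; omega
  have hF' : ∀ b : ℕ, b < t - u → ∀ hb : m + u + b < n, (⟨m + u + b, hb⟩ : Fin n) ∈ r.failed :=
    fun b _ _ => by rw [hr, mem_failed_blockRepair]; simp; omega
  have hH : ∀ j, ∀ b : ℕ, b < d - m → ∀ hb : m + t + b < n,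
      (⟨m + t + b, hb⟩ : Fin n) ∈ r.helpers j := fun j b _ _ => by
    refine (mem_helpers_blockRepair hm hn).2 ?_; simp; omega
  rw [show Fintype.card Msg ^ ((d - m) * u) * Fintype.card Coord ^ ((t - u) * u) =
    Fintype.card ((Fin u → Fin (d - m) → Msg) × (Fin u → Fin (t - u) → Coord)) by simp [pow_mul]]
  refine ncard_range_le_mul_card _ _
    (fun x => (fun a b => S.collected x h r ⟨⟨m + a, by omega⟩, hF a (by omega) _⟩
        ⟨⟨m + t + b, by omega⟩, hH _ b b.2 _⟩,
      fun a b => S.coordinate h r ⟨⟨m + u + b, by omega⟩, hF' b (by omega) _⟩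
        ⟨⟨m + a, by omega⟩, hF a (by omega) _⟩ (S.collected x h r _)))
    fun x y hg he => funext fun ⟨i, hi⟩ => ?_
  obtain ⟨he1, he2⟩ := Prod.ext_iff.1 he
  by_cases him : i.1 < m
  · have hi' : i ∉ r.failed := by rw [hr, mem_failed_blockRepair]; omega
    simp only [prefixContent, content_cons_of_notMem _ _ _ _ hi']
    exact congrFun hg ⟨i, him⟩
  -- Messages from helpers below `m` are functions of the old prefix content; the other `d - m` are
  -- recorded in `he1`.
  have hcol : ∀ l : {l // l ∈ r.failed}, l.1.1 < m + u →
      S.collected x h r l = S.collected y h r l := by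
    rintro ⟨l, hl⟩ hlu
    have hl' := (mem_failed_blockRepair hm hn).1 hl
    funext ⟨b, hb⟩
    rcases (mem_helpers_blockRepair hm hn).1 hb with hb' | hb'
    · exact congrArg (S.collect h r ⟨l, hl⟩ ⟨b, hb⟩) (congrFun hg ⟨b, hb'⟩)
    · have hlu' : l.1 < m + u := hlu
      obtain ⟨l, hln⟩ := l
      obtain ⟨b, hbn⟩ := b
      obtain ⟨a, rfl⟩ := Nat.exists_eq_add_of_le hl'.1
      obtain ⟨c, rfl⟩ := Nat.exists_eq_add_of_le hb'.1
      dsimp only at hlu' hb'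
      exact congrFun (congrFun he1 ⟨a, by omega⟩) ⟨c, by omega⟩
  have hi' : i ∈ r.failed := by rw [hr, mem_failed_blockRepair]; omega
  simp only [prefixContent, content_cons_of_mem _ _ _ _ hi']
  rw [hcol _ hi]
  congr 1
  funext ⟨⟨l, hl⟩, hne⟩
  -- Coordinating messages among the first `u` new devices follow from what these collected; only
  -- those from the other `t - u` are counted.
  by_cases hlu : l.1 < m + u
  · rw [hcol _ hlu]
  · have hl' := (mem_failed_blockRepair hm hn).1 hl
    obtain ⟨l, hln⟩ := l
    obtain ⟨i, hin⟩ := i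
    dsimp only at hlu hl' him hi
    obtain ⟨a, rfl⟩ := Nat.exists_eq_add_of_le (not_lt.1 him)
    obtain ⟨c, rfl⟩ := Nat.exists_eq_add_of_le (not_lt.1 hlu)
    exact congrFun (congrFun he2 ⟨a, by omega⟩) ⟨c, by omega⟩

theorem exists_ncard_range_prefixContent_le [Finite File] [Fintype Store] [Fintype Msg]
    [Fintype Coord] {s α β β' : ℝ}
    (hα : (Fintype.card Store : ℝ) ≤ (2 : ℝ) ^ (s * α))
    (hβ : (Fintype.card Msg : ℝ) ≤ (2 : ℝ) ^ (s * β))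
    (hβ' : (Fintype.card Coord : ℝ) ≤ (2 : ℝ) ^ (s * β'))
    (hn : d + t ≤ n) {g : ℕ} (u : Fin g → ℕ) (hu : ∀ i, u i ≤ t) (hud : ∑ i, u i ≤ d) :
    ∃ h : History n d t, ((Set.range (S.prefixContent (∑ i, u i) h)).ncard : ℝ) ≤
      (2 : ℝ) ^ (s * scenarioFlow d t α β β' u) := by
  induction g with
  | zero =>
    refine ⟨[], ?_⟩
    have : Subsingleton ({i : Fin n // i.1 < ∑ i : Fin 0, u i} → Store) := by
      have : IsEmpty {i : Fin n // i.1 < ∑ i : Fin 0, u i} := ⟨fun i => by simpa using i.2⟩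
      infer_instance
    simp only [scenarioFlow, Finset.univ_eq_empty, Finset.sum_empty, mul_zero, Real.rpow_zero]
    exact_mod_cast Set.ncard_le_one_of_subsingleton _
  | succ g ih =>
    rw [Fin.sum_univ_castSucc] at hud
    obtain ⟨h, hh⟩ := ih (fun i => u i.castSucc) (fun i => hu _) (by omega)
    have hm : ∑ i : Fin g, u i.castSucc ≤ d := by omega
    refine ⟨blockRepair hm hn :: h, ?_⟩
    have hsum : (∑ i : Fin g, (u i.castSucc : ℝ)) = ((∑ i : Fin g, u i.castSucc : ℕ) : ℝ) := by
      push_cast; rfl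
    rw [Fin.sum_univ_castSucc, scenarioFlow_succ, hsum]
    have hut := hu (Fin.last g)
    generalize (∑ i : Fin g, u i.castSucc) = m at *
    generalize u (Fin.last g) = v at *
    generalize scenarioFlow d t α β β' (fun i => u i.castSucc) = B at *
    rw [mul_add, Real.rpow_add two_pos]
    have hpow : ∀ {N e : ℕ} {a : ℝ}, (N : ℝ) ≤ (2 : ℝ) ^ a → ((N ^ e : ℕ) : ℝ) ≤ 2 ^ (a * e) :=
      fun {N e a} hN => by
        rw [Real.rpow_mul_natCast two_pos.le]
        push_cast
        exact pow_le_pow_left₀ (Nat.cast_nonneg _) hN _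
    -- The smaller argument of the minimum decides which of the two counts is used for this block.
    rcases min_choice α (((d : ℝ) - m) * β + ((t : ℝ) - v) * β') with h' | h' <;> rw [h']
    · refine (Nat.cast_le.2 (S.ncard_range_prefixContent_le_store hm hn hut h)).trans ?_
      rw [Nat.cast_mul, show s * (v * α) = s * α * v by ring]
      exact mul_le_mul hh (hpow hα) (Nat.cast_nonneg _) (by positivity)
    · refine (Nat.cast_le.2 (S.ncard_range_prefixContent_le_messages hm hn hut h)).trans ?_
      rw [Nat.cast_mul, Nat.cast_mul]
      rw [show s * (v * (((d : ℝ) - m) * β + ((t : ℝ) - v) * β')) =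
        s * β * ((d - m) * v : ℕ) + s * β' * ((t - v) * v : ℕ) by
          push_cast [hm, hut]; ring, Real.rpow_add two_pos]
      exact mul_le_mul hh (mul_le_mul (hpow hβ) (hpow hβ') (Nat.cast_nonneg _) (by positivity))
        (by positivity) (by positivity)

end Scheme

/-- The cut-set bound: every correct code satisfies the constraints. -/
theorem IsCorrectWith.satisfiesConstraints {n k d t : ℕ} {M α β β' : ℝ} (hkd : k ≤ d)
    (hn : d + t ≤ n) (hc : IsCorrectWith n k d t M α β β') :
    SatisfiesConstraints k d t M α β β' := by
  obtain ⟨s, hs, File, Store, Msg, Coord, _, _, _, _, hM, hα, hβ, hβ', S, hS⟩ := hc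
  rintro g u ⟨rfl, hu⟩
  obtain ⟨h, hh⟩ := S.exists_ncard_range_prefixContent_le hα hβ hβ' hn u
    (fun i => (hu i).2) hkd
  obtain ⟨decode, hdec⟩ := hS h ((Finset.range (∑ i, u i)).attachFin fun i hi => by
    have := Finset.mem_range.1 hi; omega) (by simp)
  have hinj : Function.Injective (S.prefixContent (∑ i, u i) h) := fun x y hxy => by
    rw [← hdec x, ← hdec y]
    exact congrArg decode (funext fun i => congrFun hxy ⟨i.1, Finset.mem_range.1 ((Finset.mem_attachFin _).1 i.2)⟩)
  rw [← Nat.card_coe_set_eq, Nat.card_range_of_injective hinj, Nat.card_eq_fintype_card] at hh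
  have := hM.trans hh
  rw [Real.rpow_le_rpow_left_iff one_lt_two] at this
  exact le_of_mul_le_mul_left this hs

/-! ### Interpolation and exact repair -/

/-- The difference polynomial has degree less than `s.card`, as its higher coefficients cancel, and
it vanishes on `s`. -/
theorem eq_of_sum_mul_pow_eq {F : Type*} [Field F] {m : ℕ} (v w : Fin m → F) (s : Finset F)
    (hvw : ∀ i : Fin m, s.card ≤ i.1 → v i = w i)
    (h : ∀ x ∈ s, ∑ i, v i * x ^ i.1 = ∑ i, w i * x ^ i.1) : v = w := by
  classical
  let p : Polynomial F := ∑ i : Fin m, Polynomial.C (v i - w i) * Polynomial.X ^ i.1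
  have hdeg : p.degree < s.card := by
    refine (Polynomial.degree_sum_le _ _).trans_lt ((Finset.sup_lt_iff (WithBot.bot_lt_coe _)).2 ?_)
    intro i _
    rcases lt_or_ge i.1 s.card with hi | hi
    · exact (Polynomial.degree_C_mul_X_pow_le _ _).trans_lt (by exact_mod_cast hi)
    · simp [hvw i hi]
  have hp : p = 0 := Polynomial.eq_zero_of_degree_lt_of_eval_finset_eq_zero s hdeg fun x hx => by
    simp [p, Polynomial.eval_finsetSum, sub_mul, Finset.sum_sub_distrib, h x hx]
  funext i
  have hi : p.coeff i.1 = v i - w i := by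
    simp only [p, Polynomial.finsetSum_coeff, Polynomial.coeff_C_mul_X_pow, Fin.val_inj]
    simp
  rw [hp, Polynomial.coeff_zero] at hi
  exact (sub_eq_zero.1 hi.symm)

theorem exists_comp_eq {X Y Z : Type*} [Nonempty Z] (f : X → Y) (g : X → Z)
    (h : ∀ x y, f x = f y → g x = g y) : ∃ φ : Y → Z, ∀ x, φ (f x) = g x := by
  obtain ⟨φ, hφ⟩ := (Function.factorsThrough_iff g).1 (fun x y hxy => h x y hxy)
  exact ⟨φ, fun x => (congrFun hφ x).symm⟩

/-- A code with exact repair: `E i` is the content of device `i`, `m i j` the message from the live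
device `i` to the new device `j`, and `c l j` that from the new device `l` to the new device `j`. -/
theorem exists_scheme_content_eq {n d t : ℕ} {File Store Msg Coord : Type} [Nonempty Store]
    [Nonempty Msg] [Nonempty Coord] (E : Fin n → File → Store) (m : Fin n → Fin n → File → Msg)
    (c : Fin n → Fin n → File → Coord)
    (hm : ∀ i j x y, E i x = E i y → m i j x = m i j y)
    (hc : ∀ l j x y (H : Finset (Fin n)), H.card = d → (∀ i ∈ H, m i l x = m i l y) →
      c l j x = c l j y)
    (hE : ∀ j x y (H L : Finset (Fin n)), H.card = d → L.card = t → j ∈ L → Disjoint H L →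
      (∀ i ∈ H, m i j x = m i j y) → (∀ l ∈ L, l ≠ j → c l j x = c l j y) → E j x = E j y) :
    ∃ S : Scheme n d t File Store Msg Coord, ∀ x h i, S.content x h i = E i x := by
  choose φ hφ using fun i j => exists_comp_eq (E i) (m i j) (hm i j)
  choose ψ hψ using fun (r : Repair n d t) (l j : {j // j ∈ r.failed}) =>
    exists_comp_eq (fun x (i : {i // i ∈ r.helpers l}) => m i.1 l.1 x) (c l.1 j.1)
      fun x y hxy => hc l.1 j.1 x y (r.helpers l) (r.card_helpers l)
        fun i hi => congrFun hxy ⟨i, hi⟩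
  choose χ hχ using fun (r : Repair n d t) (j : {j // j ∈ r.failed}) =>
    exists_comp_eq (fun x => ((fun (i : {i // i ∈ r.helpers j}) => m i.1 j.1 x),
      fun (l : {l : {l // l ∈ r.failed} // l ≠ j}) => c l.1.1 j.1 x)) (E j.1)
      fun x y hxy => hE j.1 x y (r.helpers j) r.failed (r.card_helpers j) r.card_failed j.2
        (r.helpers_live j) (fun i hi => congrFun (Prod.ext_iff.1 hxy).1 ⟨i, hi⟩)
        fun l hl hne => congrFun (Prod.ext_iff.1 hxy).2 ⟨⟨l, hl⟩, fun h => hne (congrArg Subtype.val h)⟩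
  let S : Scheme n d t File Store Msg Coord :=
    { encode := E
      collect := fun _ r j i => φ i.1 j.1
      coordinate := fun _ r l j => ψ r l j
      store := fun _ r j a b => χ r j (a, b) }
  refine ⟨S, fun x h => ?_⟩
  induction h with
  | nil => exact fun i => by rw [Scheme.content]
  | cons r h ih =>
    -- By induction the helpers hold their initial contents, so the messages do not depend on the
    -- history.
    have hcol : ∀ l, S.collected x h r l = fun i => m i.1 l.1 x := fun l => funext fun i => by
      rw [Scheme.collected, ih]; exact hφ _ _ _
    intro i
    by_cases hi : i ∈ r.failed
    · simp only [S.content_cons_of_mem x h r hi, hcol]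
      refine Eq.trans ?_ (hχ r ⟨i, hi⟩ x)
      exact congrArg (fun b => χ r ⟨i, hi⟩ (_, b)) (funext fun l => hψ r l.1 ⟨i, hi⟩ x)
    · rw [S.content_cons_of_notMem x h r hi, ih]

/-! ### The bivariate polynomial code -/

section PolynomialCode

variable {F : Type*} [Field F]

/-- The coefficients in `X` of `∑ A i j X ^ i Y ^ j` at `Y = y`. -/
def rowPoly {d e : ℕ} (A : Fin d → Fin e → F) (y : F) (i : Fin d) : F := ∑ j, A i j * y ^ j.1

/-- The coefficients in `Y` of `∑ A i j X ^ i Y ^ j` at `X = x`. -/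
def colPoly {d e : ℕ} (A : Fin d → Fin e → F) (x : F) (j : Fin e) : F := ∑ i, A i j * x ^ i.1

/-- The value of `∑ A i j X ^ i Y ^ j` at `(x, y)`. -/
def bivarEval {d e : ℕ} (A : Fin d → Fin e → F) (x y : F) : F := ∑ i, rowPoly A y i * x ^ i.1

theorem bivarEval_eq_sum_colPoly {d e : ℕ} (A : Fin d → Fin e → F) (x y : F) :
    bivarEval A x y = ∑ j, colPoly A x j * y ^ j.1 := by
  simp only [bivarEval, rowPoly, colPoly, Finset.sum_mul]
  rw [Finset.sum_comm]
  exact Finset.sum_congr rfl fun _ _ => Finset.sum_congr rfl fun _ _ => by ring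

/-- The constant coefficient in `Y` need not be stored: the row polynomial gives the value at `(x,
y)`. -/
theorem colPoly_eq_of_tail_eq {d e : ℕ} {A B : Fin d → Fin (e + 1) → F} {x y : F}
    (hrow : rowPoly A y = rowPoly B y)
    (hcol : ∀ j : Fin e, colPoly A x j.succ = colPoly B x j.succ) :
    colPoly A x = colPoly B x := by
  have h : bivarEval A x y = bivarEval B x y := by simp only [bivarEval, hrow]
  rw [bivarEval_eq_sum_colPoly, bivarEval_eq_sum_colPoly, Fin.sum_univ_succ, Fin.sum_univ_succ] at h
  simp only [hcol, Fin.val_zero, pow_zero, mul_one, add_left_inj] at h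
  exact funext fun j => Fin.cases h hcol j

/-- The coefficient matrix of a file: all entries in rows and columns of index `≥ k` vanish. -/
def coeffMatrix {k d e : ℕ} (a : (Fin k × Fin e → F) × (Fin (d - k) × Fin k → F))
    (i : Fin d) (j : Fin e) : F :=
  if hi : i.1 < k then a.1 (⟨i, hi⟩, j)
  else if hj : j.1 < k then a.2 (⟨i - k, by omega⟩, ⟨j, hj⟩) else 0

theorem coeffMatrix_of_le {k d e : ℕ} (a : (Fin k × Fin e → F) × (Fin (d - k) × Fin k → F))
    {i : Fin d} {j : Fin e} (hi : k ≤ i.1) (hj : k ≤ j.1) : coeffMatrix a i j = 0 := by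
  simp [coeffMatrix, hi.not_gt, hj.not_gt]

theorem coeffMatrix_injective {k d e : ℕ} (hkd : k ≤ d) (hke : k ≤ e) :
    Function.Injective (coeffMatrix (F := F) (k := k) (d := d) (e := e)) := by
  intro a b hab
  refine Prod.ext (funext fun ⟨i, j⟩ => ?_) (funext fun ⟨i, j⟩ => ?_)
  · simpa [coeffMatrix] using congrFun (congrFun hab ⟨i, by omega⟩) j
  · simpa [coeffMatrix] using congrFun (congrFun hab ⟨k + i, by omega⟩) ⟨j, by omega⟩

/-- Columns of index `≥ k` have only `k` free entries, so `k` column polynomials determine them.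
Each row then has at most `k` unknown entries left, which `k` row polynomials determine. -/
theorem coeffMatrix_eq_of_polys_eq {k d e : ℕ}
    {a b : (Fin k × Fin e → F) × (Fin (d - k) × Fin k → F)} (s : Finset F) (hs : s.card = k)
    (hrow : ∀ y ∈ s, rowPoly (coeffMatrix a) y = rowPoly (coeffMatrix b) y)
    (hcol : ∀ x ∈ s, colPoly (coeffMatrix a) x = colPoly (coeffMatrix b) x) :
    coeffMatrix a = coeffMatrix b := by
  have h1 : ∀ j : Fin e, k ≤ j.1 → ∀ i, coeffMatrix a i j = coeffMatrix b i j := fun j hj =>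
    congrFun (eq_of_sum_mul_pow_eq (fun i => coeffMatrix a i j) (fun i => coeffMatrix b i j) s
      (fun i hi => by simp only [coeffMatrix_of_le _ (hs ▸ hi) hj])
      fun x hx => congrFun (hcol x hx) j)
  exact funext fun i => eq_of_sum_mul_pow_eq _ _ s (fun j hj => h1 j (hs ▸ hj) i)
    fun y hy => congrFun (hrow y hy) i

end PolynomialCode

theorem exists_recovering_scheme {n k d t e : ℕ} (F : Type) [Field F] (pt : Fin n → F)
    (hpt : Function.Injective pt) (hkd : k ≤ d) (he : e + 1 = d + t) :
    ∃ S : Scheme n d t ((Fin k × Fin (e + 1) → F) × (Fin (d - k) × Fin k → F))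
      ((Fin d → F) × (Fin e → F)) (F × F) F, S.Recovers k := by
  classical
  let E : Fin n → ((Fin k × Fin (e + 1) → F) × (Fin (d - k) × Fin k → F)) →
      (Fin d → F) × (Fin e → F) := fun i a =>
    (rowPoly (coeffMatrix a) (pt i), fun j => colPoly (coeffMatrix a) (pt i) j.succ)
  have hE : ∀ i a b, E i a = E i b →
      rowPoly (coeffMatrix a) (pt i) = rowPoly (coeffMatrix b) (pt i) ∧
      colPoly (coeffMatrix a) (pt i) = colPoly (coeffMatrix b) (pt i) := fun i a b h =>
    have h' := Prod.ext_iff.1 h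
    ⟨h'.1, colPoly_eq_of_tail_eq h'.1 fun j => congrFun h'.2 j⟩
  have hrow : ∀ (l : Fin n) (a b : (Fin k × Fin (e + 1) → F) × (Fin (d - k) × Fin k → F))
      (H : Finset (Fin n)), H.card = d →
      (∀ i ∈ H, bivarEval (coeffMatrix a) (pt i) (pt l) =
        bivarEval (coeffMatrix b) (pt i) (pt l)) →
      rowPoly (coeffMatrix a) (pt l) = rowPoly (coeffMatrix b) (pt l) := by
    intro l a b H hH h
    refine eq_of_sum_mul_pow_eq _ _ (H.image pt) (fun i hi => ?_) fun x hx => ?_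
    · rw [Finset.card_image_of_injective _ hpt] at hi; omega
    · obtain ⟨i, hi, rfl⟩ := Finset.mem_image.1 hx
      exact h i hi
  obtain ⟨S, hS⟩ : ∃ S : Scheme n d t _ _ (F × F) F, ∀ x h i, S.content x h i = E i x := by
    refine exists_scheme_content_eq E
      (fun i j a => (bivarEval (coeffMatrix a) (pt i) (pt j),
        bivarEval (coeffMatrix a) (pt j) (pt i)))
      (fun l j a => bivarEval (coeffMatrix a) (pt j) (pt l)) ?_ ?_ ?_
    · intro i j a b h
      obtain ⟨h1, h2⟩ := hE i a b h
      simp only [Prod.mk.injEq]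
      refine ⟨?_, ?_⟩
      · rw [bivarEval_eq_sum_colPoly, bivarEval_eq_sum_colPoly, h2]
      · rw [bivarEval, bivarEval, h1]
    · intro l j a b H hH h
      rw [bivarEval, bivarEval, hrow l a b H hH fun i hi => (Prod.ext_iff.1 (h i hi)).1]
    · intro j a b H L hH hL hj hdisj h1 h2
      have hr := hrow j a b H hH fun i hi => (Prod.ext_iff.1 (h1 i hi)).1
      -- The `d + t` coefficients are interpolated from `d` helpers, `t - 1` other new devices, and
      -- the device's own value at `(p_j, p_j)`, read off its recovered row polynomial.
      have hc : colPoly (coeffMatrix a) (pt j) = colPoly (coeffMatrix b) (pt j) := by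
        refine eq_of_sum_mul_pow_eq _ _ ((H ∪ L).image pt) (fun i hi => ?_) fun x hx => ?_
        · rw [Finset.card_image_of_injective _ hpt, Finset.card_union_of_disjoint hdisj] at hi
          omega
        · obtain ⟨i, hi, rfl⟩ := Finset.mem_image.1 hx
          rw [← bivarEval_eq_sum_colPoly, ← bivarEval_eq_sum_colPoly]
          rcases Finset.mem_union.1 hi with hi | hi
          · exact (Prod.ext_iff.1 (h1 i hi)).2
          · by_cases hij : i = j
            · rw [hij, bivarEval, bivarEval, hr]
            · exact h2 i hi hij
      exact Prod.ext hr (funext fun i => congrFun hc i.succ)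
  refine ⟨S, fun h K hK => ?_⟩
  refine exists_comp_eq (fun x (i : {i // i ∈ K}) => S.content x h i.1) id fun a b hab => ?_
  have hab' : ∀ i ∈ K, E i a = E i b := fun i hi => by
    simpa only [hS] using congrFun hab ⟨i, hi⟩
  refine coeffMatrix_injective hkd (by omega) (coeffMatrix_eq_of_polys_eq (K.image pt)
    (by rw [Finset.card_image_of_injective _ hpt, hK]) ?_ ?_)
  · exact Finset.forall_mem_image.2 fun i hi => (hE i a b (hab' i hi)).1
  · exact Finset.forall_mem_image.2 fun i hi => (hE i a b (hab' i hi)).2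

/-- The minimum bandwidth values, in the unit `b`, are attained. -/
theorem isCorrectWith_mbcr {n k d t : ℕ} {b : ℝ} (hb : 0 < b) (hkd : k ≤ d) (ht : 1 ≤ t) :
    IsCorrectWith n k d t (k * (2 * d - k + t) * b) ((2 * d + t - 1) * b) (2 * b) b := by
  -- A prime `p ≥ n` provides `n` distinct evaluation points.
  obtain ⟨p, hp, hprime⟩ := Nat.exists_infinite_primes n
  have : Fact p.Prime := ⟨hprime⟩
  have hinj : Function.Injective fun i : Fin n => ((i.1 : ℕ) : ZMod p) := fun i j hij =>
    Fin.ext (by simpa [ZMod.natCast_eq_natCast_iff', Nat.mod_eq_of_lt (i.2.trans_le hp),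
      Nat.mod_eq_of_lt (j.2.trans_le hp)] using hij)
  obtain ⟨S, hS⟩ := exists_recovering_scheme (k := k) (d := d) (t := t) (e := d + t - 1)
    (ZMod p) _ hinj hkd (by omega)
  have hp1 : (1 : ℝ) < p := by exact_mod_cast hprime.one_lt
  -- With `s = logb 2 p / b`, an amount `b` is exactly one symbol of `ZMod p`.
  have hpow : ∀ (a : ℝ) (N : ℕ), a = N * b →
      (2 : ℝ) ^ (Real.logb 2 p / b * a) = (p : ℝ) ^ N := by
    rintro _ N rfl
    rw [show Real.logb 2 p / b * (N * b) = Real.logb 2 p * N by field_simp,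
      Real.rpow_mul_natCast two_pos.le, Real.rpow_logb two_pos (by norm_num) (by linarith)]
  refine ⟨Real.logb 2 p / b, div_pos (Real.logb_pos one_lt_two hp1) hb, _, _, _, _,
    inferInstance, inferInstance, inferInstance, inferInstance, ?_, ?_, ?_, ?_, S, hS⟩
  · rw [hpow _ (k * (d + t - 1 + 1) + (d - k) * k) (by
      rw [Nat.sub_add_cancel (by omega)]; push_cast [hkd]; ring)]
    simp [ZMod.card, pow_add]
  · rw [hpow _ (d + (d + t - 1)) (by
      rw [Nat.add_sub_assoc ht]; push_cast [ht]; ring)]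
    simp [ZMod.card, pow_add]
  · rw [hpow _ 2 (by norm_num)]
    simp [ZMod.card, pow_two]
  · rw [hpow _ 1 (by norm_num)]
    simp [ZMod.card]

/-! ### Consequences of the two extreme scenarios -/

theorem scenarioFlow_lt_of_repairCost {k d t : ℕ} {b : ℝ} (hk : 1 ≤ k) {α β β' : ℝ}
    (hβ : 2 * b ≤ β)
    (h : repairCost d t β β' < (2 * d + t - 1) * b ∨
      (α < (2 * d + t - 1) * b ∧ repairCost d t β β' ≤ (2 * d + t - 1) * b)) :
    scenarioFlow d t α β β' (scenarioOne k) < k * (2 * d - k + t) * b := by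
  have hk' : (1 : ℝ) ≤ k := by exact_mod_cast hk
  have h1 : 2 * b * (k * (k - 1) / 2) ≤ β * (k * (k - 1) / 2) :=
    mul_le_mul_of_nonneg_right hβ (by nlinarith)
  rcases h with h | ⟨h, h'⟩
  · have h2 := scenarioFlow_scenarioOne_le d t k α β β'
    have h3 := mul_lt_mul_of_pos_left h (by linarith : (0 : ℝ) < k)
    linarith
  · have h2 := scenarioFlow_scenarioOne_le_storage d t hk α β β'
    have h3 := mul_le_mul_of_nonneg_left h' (by linarith : (0 : ℝ) ≤ k - 1)
    linarith

theorem scenarioFlow_scenarioAll_lt {k d t : ℕ} {b : ℝ} (hk : 1 ≤ k) (ht : 1 ≤ t) (hkd : k ≤ d)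
    (htk : t ∣ k) {α β β' : ℝ} (hβ : β < 2 * b) :
    scenarioFlow d t α β β' (scenarioAll k t) < k * (2 * d - k + t) * b := by
  have hk' : (1 : ℝ) ≤ k := by exact_mod_cast hk
  have ht' : (1 : ℝ) ≤ t := by exact_mod_cast ht
  have hkd' : (k : ℝ) ≤ d := by exact_mod_cast hkd
  have h1 := scenarioFlow_scenarioAll_le d htk α β β'
  have h2 := mul_lt_mul_of_pos_right hβ
    (mul_pos (by linarith) (by linarith) : (0 : ℝ) < k * (2 * d - k + t))
  linarith

theorem eq_of_satisfiesConstraints {k d t : ℕ} {b : ℝ} (hk : 1 ≤ k) (ht : 1 ≤ t) (hkd : k ≤ d)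
    (htk : t ∣ k) {α β β' : ℝ}
    (hc : SatisfiesConstraints k d t (k * (2 * d - k + t) * b) α β β')
    (h : repairCost d t β β' = (2 * d + t - 1) * b) : β = 2 * b ∧ (2 ≤ t → β' = b) := by
  have hd : (0 : ℝ) < d := by exact_mod_cast hk.trans hkd
  have hβ : β = 2 * b := by
    refine le_antisymm ?_ (not_lt.1 fun hlt => (hc _ _ (isScenario_scenarioAll ht htk)).not_gt
      (scenarioFlow_scenarioAll_lt hk ht hkd htk hlt))
    -- For `k = 1` the scenario `(1, …, 1)` does not bound `β` separately, but then `t = 1` and the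
    -- repair cost is `d * β`.
    rcases hk.eq_or_lt with rfl | hk
    · obtain rfl : t = 1 := Nat.dvd_one.1 htk
      simp only [repairCost, Nat.cast_one] at h
      exact le_of_mul_le_mul_left (by linarith) hd
    · have hk' : (1 : ℝ) < k := by exact_mod_cast hk
      have h1 := hc _ _ (isScenario_scenarioOne ht)
      have h2 := scenarioFlow_scenarioOne_le d t k α β β'
      rw [h] at h2
      exact le_of_mul_le_mul_right (by linarith)
        (mul_pos (by linarith) (by linarith) : (0 : ℝ) < k * (k - 1))
  refine ⟨hβ, fun ht2 => ?_⟩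
  have ht' : (1 : ℝ) < t := by exact_mod_cast ht2
  subst hβ
  simp only [repairCost] at h
  exact mul_left_cancel₀ (sub_pos.2 ht').ne' (by linarith)

end CoordRegen

theorem mainTheorem2 (n k d t : ℕ) (M : ℝ) (hM : 0 < M) (hk : 1 ≤ k) (ht : 1 ≤ t)
    (htk : t ∣ k) (hkd : k ≤ d) (hn : d + t ≤ n)
    (α β β' γ : ℝ)
    (hα : α = CoordRegen.mbcrAlpha k d t M)
    (hβ : β = CoordRegen.mbcrBeta k d t M)
    (hβ' : β' = CoordRegen.mbcrBeta' k d t M)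
    (hγ : γ = CoordRegen.repairCost d t β β') :
    -- the repair cost equals the storage cost
    γ = α ∧
    -- every constraint is satisfied, and the code is correct with these values
    CoordRegen.SatisfiesConstraints k d t M α β β' ∧
    CoordRegen.IsCorrectWith n k d t M α β β' ∧
    CoordRegen.IsCorrect n k d t M α γ ∧
    -- smaller values violate the constraint of `(t, …, t)` or that of `(1, …, 1)`
    CoordRegen.IsScenario k t (CoordRegen.scenarioAll k t) ∧
    CoordRegen.IsScenario k t (CoordRegen.scenarioOne k) ∧
    (∀ α₁ β₁ β₁' : ℝ, β₁ < β →
      CoordRegen.scenarioFlow d t α₁ β₁ β₁' (CoordRegen.scenarioAll k t) < M) ∧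
    (∀ α₁ β₁ β₁' : ℝ,
      (CoordRegen.repairCost d t β₁ β₁' < γ ∨
        (α₁, CoordRegen.repairCost d t β₁ β₁') < (α, γ)) →
      CoordRegen.scenarioFlow d t α₁ β₁ β₁' (CoordRegen.scenarioAll k t) < M ∨
      CoordRegen.scenarioFlow d t α₁ β₁ β₁' (CoordRegen.scenarioOne k) < M) ∧
    -- `β`, `β'` are the only values that satisfy the constraints at this repair cost
    (∀ α₁ β₁ β₁' : ℝ, CoordRegen.SatisfiesConstraints k d t M α₁ β₁ β₁' →
      CoordRegen.repairCost d t β₁ β₁' = γ → β₁ = β ∧ (2 ≤ t → β₁' = β')) ∧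
    -- the code is optimal, has the least repair cost of all correct codes, and the least storage
    -- cost among the correct codes of that repair cost
    CoordRegen.IsOptimal n k d t M α γ ∧
    (∀ α₁ γ₁ : ℝ, CoordRegen.IsCorrect n k d t M α₁ γ₁ → γ ≤ γ₁ ∧ (γ₁ = γ → α ≤ α₁)) := by
  have hk' : (1 : ℝ) ≤ k := by exact_mod_cast hk
  have ht' : (1 : ℝ) ≤ t := by exact_mod_cast ht
  have hkd' : (k : ℝ) ≤ d := by exact_mod_cast hkd
  have hden : (0 : ℝ) < 2 * d - k + t := by linarith
  -- All sizes become multiples of the common unit `b = β'`.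
  obtain ⟨b, hbdef⟩ : ∃ b, b = M / k * (1 / (2 * d - k + t)) := ⟨_, rfl⟩
  have hb : 0 < b := hbdef ▸ mul_pos (div_pos hM (by linarith)) (div_pos one_pos hden)
  have hβ2 : β = 2 * β' := by rw [hβ, hβ', CoordRegen.mbcrBeta, CoordRegen.mbcrBeta']; ring
  have hα2 : α = (2 * d + t - 1) * β' := by
    rw [hα, hβ', CoordRegen.mbcrAlpha, CoordRegen.mbcrBeta']; ring
  obtain rfl : M = k * (2 * d - k + t) * b := by
    rw [hbdef]; field_simp
  obtain rfl : β' = b := hβ'.trans hbdef.symm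
  clear hα hβ hβ' hbdef
  subst hβ2 hα2
  obtain rfl : γ = (2 * d + t - 1) * β' := by rw [hγ, CoordRegen.repairCost]; ring
  have hsmall : ∀ α₁ β₁ β₁' : ℝ,
      (CoordRegen.repairCost d t β₁ β₁' < (2 * d + t - 1) * β' ∨
        (α₁, CoordRegen.repairCost d t β₁ β₁') < ((2 * d + t - 1) * β', (2 * d + t - 1) * β')) →
      CoordRegen.scenarioFlow d t α₁ β₁ β₁' (CoordRegen.scenarioAll k t) < k * (2 * d - k + t) * β' ∨
      CoordRegen.scenarioFlow d t α₁ β₁ β₁' (CoordRegen.scenarioOne k) < k * (2 * d - k + t) * β' := by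
    intro α₁ β₁ β₁' h
    rcases lt_or_ge β₁ (2 * β') with hβ | hβ
    · exact Or.inl (CoordRegen.scenarioFlow_scenarioAll_lt hk ht hkd htk hβ)
    · refine Or.inr (CoordRegen.scenarioFlow_lt_of_repairCost hk hβ ?_)
      rcases h with h | h
      · exact Or.inl h
      · rcases Prod.mk_lt_mk.1 h with h | h
        exacts [Or.inr h, Or.inl h.2]
  have hincorrect : ∀ α₁ γ₁ : ℝ, (γ₁ < (2 * d + t - 1) * β' ∨
      (α₁, γ₁) < ((2 * d + t - 1) * β', (2 * d + t - 1) * β')) →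
      ¬ CoordRegen.IsCorrect n k d t (k * (2 * d - k + t) * β') α₁ γ₁ := by
    rintro α₁ _ h ⟨β₁, β₁', rfl, hc⟩
    have hc := hc.satisfiesConstraints hkd hn
    rcases hsmall α₁ β₁ β₁' h with h | h
    exacts [(hc _ _ (CoordRegen.isScenario_scenarioAll ht htk)).not_gt h,
      (hc _ _ (CoordRegen.isScenario_scenarioOne ht)).not_gt h]
  have hcorrect : CoordRegen.IsCorrectWith n k d t (k * (2 * d - k + t) * β') ((2 * d + t - 1) * β')
      (2 * β') β' := CoordRegen.isCorrectWith_mbcr hb hkd ht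
  refine ⟨rfl, hcorrect.satisfiesConstraints hkd hn, hcorrect, ⟨_, _, hγ, hcorrect⟩,
    CoordRegen.isScenario_scenarioAll ht htk, CoordRegen.isScenario_scenarioOne ht,
    fun _ _ _ h => CoordRegen.scenarioFlow_scenarioAll_lt hk ht hkd htk h, hsmall,
    fun _ _ _ h h' => CoordRegen.eq_of_satisfiesConstraints hk ht hkd htk h h',
    ⟨⟨_, _, hγ, hcorrect⟩, fun α₁ γ₁ h => hincorrect α₁ γ₁ (Or.inr h)⟩, fun α₁ γ₁ h => ⟨?_, ?_⟩⟩
  · exact not_lt.1 fun hlt => hincorrect _ _ (Or.inl hlt) h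
  · rintro rfl
    exact not_lt.1 fun hlt => hincorrect _ _ (Or.inr (Prod.mk_lt_mk.2 (Or.inl ⟨hlt, le_rfl⟩))) h
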